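/- Let $\Gamma_1\colon\mathbb R^n\rightrightarrows\mathbb R^{\ell_1}$ and $\Gamma_2\colon\mathbb R^n\rightrightarrows\mathbb R^{\ell_2}$ be set-valued mappings with closed graphs, where all spaces (and products of them) carry the Euclidean inner product and norm. Let $\Gamma(x):=\Gamma_1(x)\times\Gamma_2(x)$ and $$M(p_1,p_2,q_1,q_2):=\{(x,z_1,z_2,y_1,y_2)\mid x-y_i=p_i,\ q_i\in\Gamma_i(y_i)-z_i,\ i=1,2\}.$$ Notation. Write $t_k\downarrow0$ if $t_k>0$ and $t_k\to0$. For $\Omega\subset\mathbb R^d$ and $z\in\Omega$, let $T_\Omega(z):=\{w\mid\exists t_k\downarrow0,\ w_k\to w:\ z+t_kw_k\in\Omega\ \forall k\}$ and $\widehat N_\Omega(z):=\{z^*\mid\langle z^*,w\rangle\le0\ \forall w\in T_\Omega(z)\}$. Let $N_\Omega(z)$ be the set of all limits of sequences $z_k^*\in\widehat N_\Omega(z_k)$ with $z_k\to z$, and let $N_\Omega(z;w)$ be the set of all limits of sequences $z_k^*\in\widehat N_\Omega(z+t_kw_k)$ with $t_k\downarrow0$, $w_k\to w$. All these sets are empty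 if $z\notin\Omega$. For a set-valued mapping $S$ with graph $\operatorname{gph}S=\{(y,x)\mid x\in S(y)\}$, put $DS(y,x)(v)=\{u\mid (v,u)\in T_{\operatorname{gph}S}(y,x)\}$, $\widehat D^*S(y,x)(x^*)=\{y^*\mid (y^*,-x^*)\in\widehat N_{\operatorname{gph}S}(y,x)\}$, $D^*S(y,x)(x^*)=\{y^*\mid (y^*,-x^*)\in N_{\operatorname{gph}S}(y,x)\}$, and $D^*S((y,x);(v,u))(x^*)=\{y^*\mid (y^*,-x^*)\in N_{\operatorname{gph}S}((y,x);(v,u))\}$. The mapping $S$ is calm at $(\bar y,\bar x)\in\operatorname{gph}S$ if there is $\kappa>0$ such that for all sequences $x_k\to\bar x$ and $(y_k)$ with $x_k\in S(y_k)$ for all $k$, there is a sequence $(\tilde x_k)\subset S(\bar y)$ with $\|x_k-\tilde x_k\|\le\kappa\|y_k-\bar y\|$ for all sufficiently large $k$. It is calm at $(\bar y,\bar x)$ in direction $d$ if this property is required only for sequences of the form $x_k=\bar x+t_kd_k$ with $t_k\downarrow0$ and $d_k\to d$. Theorem. Fix $(\bar x,(\bar z_1,\bar z_2))\in\operatorname{gph}\Gamma$.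 Then the following assertions hold. (D) For every $u\in\mathbb R^n$, $$D\Gamma(\bar x,(\bar z_1,\bar z_2))(u)\subset D\Gamma_1(\bar x,\bar z_1)(u)\times D\Gamma_2(\bar x,\bar z_2)(u),$$ and the opposite inclusion holds if $M$ is calm at $((0,0,0,0),(\bar x,\bar z_1,\bar z_2,\bar x,\bar x))$ and, for all $w_1\in\mathbb R^{\ell_1}$ and $w_2\in\mathbb R^{\ell_2}$, $$((u,w_1),(u,w_2))\in T_{\operatorname{gph}\Gamma_1\times\operatorname{gph}\Gamma_2}((\bar x,\bar z_1),(\bar x,\bar z_2))\iff w_i\in D\Gamma_i(\bar x,\bar z_i)(u),\ i=1,2.$$ ($\widehat{\mathrm D}^*$) For every $z^*=(z_1^*,z_2^*)\in\mathbb R^{\ell_1}\times\mathbb R^{\ell_2}$, $$\widehat D^*\Gamma(\bar x,(\bar z_1,\bar z_2))(z^*)\supset\widehat D^*\Gamma_1(\bar x,\bar z_1)(z_1^*)+\widehat D^*\Gamma_2(\bar x,\bar z_2)(z_2^*).$$ ($\mathrm D^*$) If $M$ is calm at $((0,0,0,0),(\bar x,\bar z_1,\bar z_2,\bar x,\bar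 x))$, then for every $z^*=(z_1^*,z_2^*)$, $$D^*\Gamma(\bar x,(\bar z_1,\bar z_2))(z^*)\subset D^*\Gamma_1(\bar x,\bar z_1)(z_1^*)+D^*\Gamma_2(\bar x,\bar z_2)(z_2^*).$$ ($\mathrm{dD}^*$) For every direction $(u,w_1,w_2)\in\mathbb R^n\times\mathbb R^{\ell_1}\times\mathbb R^{\ell_2}$: if $M$ is calm at $((0,0,0,0),(\bar x,\bar z_1,\bar z_2,\bar x,\bar x))$ in direction $(u,w_1,w_2,u,u)$, then for every $z^*=(z_1^*,z_2^*)$, $$D^*\Gamma\bigl((\bar x,(\bar z_1,\bar z_2));(u,(w_1,w_2))\bigr)(z^*)\subset D^*\Gamma_1((\bar x,\bar z_1);(u,w_1))(z_1^*)+D^*\Gamma_2((\bar x,\bar z_2);(u,w_2))(z_2^*).$$ -/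

import Mathlib

open Filter
open scoped Topology Pointwise

/-- The product `E × F` of two inner product spaces with its Euclidean (`ℓ²`) structure. -/
abbrev L2Prod (E F : Type*) : Type _ := WithLp 2 (E × F)

/-- The element `(a, b)` of the Euclidean product. -/
abbrev pair {E F : Type*} (a : E) (b : F) : L2Prod E F := WithLp.toLp 2 (a, b)

/-- The Cartesian product `A × B` as a subset of the Euclidean product. -/
def prodSet {E F : Type*} (A : Set E) (B : Set F) : Set (L2Prod E F) :=
  {p | p.fst ∈ A ∧ p.snd ∈ B}

section Cones

variable {E : Type*} [NormedAddCommGroup E] [InnerProductSpace ℝ E]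

/-- `t_k ↓ 0`: positive reals converging to zero. -/
def TendsDownToZero (t : ℕ → ℝ) : Prop :=
  (∀ k, 0 < t k) ∧ Tendsto t atTop (𝓝 0)

/-- The sequence `z_k` converges to `z` from direction `w`:
`z_k = z + t_k w_k` with `t_k ↓ 0` and `w_k → w`. -/
def ConvergesFrom (zk : ℕ → E) (z w : E) : Prop :=
  ∃ (t : ℕ → ℝ) (wk : ℕ → E), TendsDownToZero t ∧ Tendsto wk atTop (𝓝 w) ∧
    ∀ k, zk k = z + t k • wk k

/-- The polar cone `Ω° = {z* | ⟨z*, z⟩ ≤ 0 for all z ∈ Ω}`. -/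
def polarCone (Ω : Set E) : Set E := {zs | ∀ z ∈ Ω, inner ℝ zs z ≤ 0}

/-- The tangent (Bouligand) cone `T_Ω(z)`; empty for `z ∉ Ω`. -/
def bouligandCone (Ω : Set E) (z : E) : Set E :=
  {w | z ∈ Ω ∧ ∃ (t : ℕ → ℝ) (wk : ℕ → E), TendsDownToZero t ∧ Tendsto wk atTop (𝓝 w) ∧
    ∀ k, z + t k • wk k ∈ Ω}

/-- The regular (Fréchet) normal cone, the polar of `T_Ω(z)`; empty for `z ∉ Ω`. -/
def regularNormalCone (Ω : Set E) (z : E) : Set E :=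
  {zs | z ∈ Ω ∧ zs ∈ polarCone (bouligandCone Ω z)}

/-- The limiting (Mordukhovich) normal cone; empty for `z ∉ Ω`. -/
def limitingNormalCone (Ω : Set E) (z : E) : Set E :=
  {zs | z ∈ Ω ∧ ∃ zk zsk : ℕ → E, Tendsto zk atTop (𝓝 z) ∧ Tendsto zsk atTop (𝓝 zs) ∧
    ∀ k, zsk k ∈ regularNormalCone Ω (zk k)}

/-- The directional limiting normal cone in direction `w`; empty for `z ∉ Ω`. -/
def dirLimitingNormalCone (Ω : Set E) (z w : E) : Set E :=
  {zs | z ∈ Ω ∧ ∃ (t : ℕ → ℝ) (wk zsk : ℕ → E), TendsDownToZero t ∧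
    Tendsto wk atTop (𝓝 w) ∧ Tendsto zsk atTop (𝓝 zs) ∧
    ∀ k, zsk k ∈ regularNormalCone Ω (z + t k • wk k)}

end Cones

section Mappings

variable {E F : Type*} [NormedAddCommGroup E] [InnerProductSpace ℝ E]
  [NormedAddCommGroup F] [InnerProductSpace ℝ F]

/-- The graph of a set-valued mapping. -/
def gph {E F : Type*} (S : E → Set F) : Set (L2Prod E F) := {p | p.snd ∈ S p.fst}

/-- The graphical (Bouligand) derivative `DS(x, z)`. -/
def graphDeriv (S : E → Set F) (x : E) (z : F) (u : E) : Set F :=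
  {w | pair u w ∈ bouligandCone (gph S) (pair x z)}

/-- The regular (Fréchet) coderivative. -/
def regularCoderiv (S : E → Set F) (x : E) (z : F) (zs : F) : Set E :=
  {xs | pair xs (-zs) ∈ regularNormalCone (gph S) (pair x z)}

/-- The limiting (Mordukhovich) coderivative. -/
def limitingCoderiv (S : E → Set F) (x : E) (z : F) (zs : F) : Set E :=
  {xs | pair xs (-zs) ∈ limitingNormalCone (gph S) (pair x z)}

/-- The directional limiting coderivative in direction `(u, w)`. -/
def dirLimitingCoderiv (S : E → Set F) (x : E) (z : F) (u : E) (w : F) (zs : F) : Set E :=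
  {xs | pair xs (-zs) ∈ dirLimitingNormalCone (gph S) (pair x z) (pair u w)}

/-- `S` is calm at the point `(y, x)` of its graph. -/
def IsCalmAt (S : E → Set F) (y : E) (x : F) : Prop :=
  ∃ κ : ℝ, 0 < κ ∧ ∀ (xk : ℕ → F) (yk : ℕ → E), Tendsto xk atTop (𝓝 x) →
    (∀ k, xk k ∈ S (yk k)) →
    ∃ xt : ℕ → F, (∀ k, xt k ∈ S y) ∧ ∀ᶠ k in atTop, ‖xk k - xt k‖ ≤ κ * ‖yk k - y‖

/-- `S` is calm at the point `(y, x)` of its graph in direction `v` (a direction in the range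
space). -/
def IsCalmAtInDir (S : E → Set F) (y : E) (x v : F) : Prop :=
  ∃ κ : ℝ, 0 < κ ∧ ∀ (xk : ℕ → F) (yk : ℕ → E), ConvergesFrom xk x v →
    (∀ k, xk k ∈ S (yk k)) →
    ∃ xt : ℕ → F, (∀ k, xt k ∈ S y) ∧ ∀ᶠ k in atTop, ‖xk k - xt k‖ ≤ κ * ‖yk k - y‖

end Mappings

/-- The product mapping `Γ(x) = Γ₁(x) × Γ₂(x)`. -/
def productMap {E F₁ F₂ : Type*} (Γ₁ : E → Set F₁) (Γ₂ : E → Set F₂) :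
    E → Set (L2Prod F₁ F₂) :=
  fun x => prodSet (Γ₁ x) (Γ₂ x)

/-- The point `(x, z₁, z₂, y₁, y₂)` in the range space of the perturbation mapping. -/
abbrev quint {E F₁ F₂ : Type*} (x : E) (z₁ : F₁) (z₂ : F₂) (y₁ y₂ : E) :
    L2Prod E (L2Prod (L2Prod F₁ F₂) (L2Prod E E)) :=
  pair x (pair (pair z₁ z₂) (pair y₁ y₂))

/-- The perturbation mapping
`M(p₁, p₂, q₁, q₂) = {(x, z₁, z₂, y₁, y₂) | x - yᵢ = pᵢ, qᵢ ∈ Γᵢ(yᵢ) - zᵢ, i = 1, 2}`. -/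
def perturbationMap {E F₁ F₂ : Type*} [AddGroup E] [AddGroup F₁] [AddGroup F₂]
    (Γ₁ : E → Set F₁) (Γ₂ : E → Set F₂) :
    L2Prod (L2Prod E E) (L2Prod F₁ F₂) →
      Set (L2Prod E (L2Prod (L2Prod F₁ F₂) (L2Prod E E))) :=
  fun r => {s | ∃ (x : E) (z₁ : F₁) (z₂ : F₂) (y₁ y₂ : E), s = quint x z₁ z₂ y₁ y₂ ∧
    x - y₁ = r.fst.fst ∧ x - y₂ = r.fst.snd ∧
    r.snd.fst ∈ (fun v => v - z₁) '' Γ₁ y₁ ∧ r.snd.snd ∈ (fun v => v - z₂) '' Γ₂ y₂}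

/-! Projecting tangents of the product graph to each factor gives the first inclusion in (D) and, by
polarity, the regular coderivative rule; neither needs calmness.

For the other claims, calmness of `perturbationMap` at the parameter `p₂ = y₁ - y₂` (up to labels,
with all other parameters zero) is an error bound: graph points `(y₁, z₁)`, `(y₂, z₂)` near the
reference point lie within `κ‖y₁ - y₂‖` of the product graph. Along tangent sequences this
correction is `o(t_k)`, which completes (D).

For limiting normals the error bound acts as exact penalization. A regular normal `ξ` to the product
graph satisfies its Fréchet inequality on pairs from the two graphs, up to `(ε + ‖ξ‖)κ` times the
gap `‖y₁ - y₂‖` (`exists_regularNormals_of_hasGraphErrorBound`). Minimizing a smoothed penalty over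
a compact set and applying Fermat's rule in each variable separately yields regular normals to the
two graphs, with opposite multipliers `±c` from the gap term
(`exists_regularNormals_of_le_norm_fst_sub`). Since `‖c‖ ≤ (ε + ‖ξ‖)κ`, the multipliers converge
along a subsequence, and their limit splits the first component of the limiting normal
(`exists_subseq_regularNormals`). -/

/-! ### Smooth majorant of the norm -/

section SmoothNorm

variable {E : Type*} [NormedAddCommGroup E]

theorem isLocalMinOn_of_isMinOn_inter_closedBall {Ω : Set E} {z c : E} {r : ℝ} {f : E → ℝ}
    (hz : ‖z - c‖ < r) (hmin : ∀ v ∈ Ω, ‖v - c‖ ≤ r → f z ≤ f v) : IsLocalMinOn f Ω z := by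
  have hnhds : Metric.ball c r ∈ 𝓝 z :=
    Metric.isOpen_ball.mem_nhds (by simpa [dist_eq_norm] using hz)
  filter_upwards [mem_nhdsWithin_of_mem_nhds hnhds, self_mem_nhdsWithin] with v hv hvΩ
  exact hmin v hvΩ (by simpa [dist_eq_norm] using (Metric.mem_ball.1 hv).le)

/-- A smooth approximation of the norm from above. -/
noncomputable def smoothNorm (δ : ℝ) (v : E) : ℝ := √(‖v‖ ^ 2 + δ ^ 2)

theorem norm_le_smoothNorm (δ : ℝ) (v : E) : ‖v‖ ≤ smoothNorm δ v :=
  Real.le_sqrt_of_sq_le (le_add_of_nonneg_right (sq_nonneg δ))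

theorem smoothNorm_zero {δ : ℝ} (hδ : 0 ≤ δ) : smoothNorm δ (0 : E) = δ := by
  simp [smoothNorm, hδ]

theorem smoothNorm_pos {δ : ℝ} (hδ : 0 < δ) (v : E) : 0 < smoothNorm δ v :=
  Real.sqrt_pos.2 (by positivity)

theorem smoothNorm_sub_comm (δ : ℝ) (v w : E) : smoothNorm δ (v - w) = smoothNorm δ (w - v) := by
  rw [smoothNorm, smoothNorm, norm_sub_rev]

theorem continuous_smoothNorm (δ : ℝ) : Continuous (smoothNorm δ : E → ℝ) := by
  unfold smoothNorm
  fun_prop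

/-- The vector is the gradient of `c * smoothNorm δ` at `v`. The bound does not involve `δ`, so
smoothing costs nothing in the multiplier estimates. -/
theorem norm_smul_inv_smoothNorm_le {δ : ℝ} (hδ : 0 < δ) [NormedSpace ℝ E] (v : E) {c : ℝ} (hc : 0 ≤ c) :
    ‖(c * (smoothNorm δ v)⁻¹) • v‖ ≤ c := by
  have h := smoothNorm_pos hδ v
  rw [norm_smul, Real.norm_eq_abs, abs_of_nonneg (by positivity), mul_assoc]
  refine mul_le_of_le_one_right hc ?_
  rw [inv_mul_le_iff₀ h, mul_one]
  exact norm_le_smoothNorm δ v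

end SmoothNorm

/-! ### Fréchet inequality and Fermat's rule for regular normals -/

section RegularNormals

variable {E F : Type*} [NormedAddCommGroup E] [InnerProductSpace ℝ E]
  [NormedAddCommGroup F] [InnerProductSpace ℝ F]

/-- In a proper space, regular normals satisfy the Fréchet inequality
`⟨ξ, v - z⟩ ≤ ε ‖v - z‖` near `z`. -/
theorem exists_radius_of_mem_regularNormalCone [ProperSpace E] {Ω : Set E} {z ξ : E}
    (hξ : ξ ∈ regularNormalCone Ω z) {ε : ℝ} (hε : 0 < ε) :
    ∃ r > 0, ∀ v ∈ Ω, ‖v - z‖ ≤ r → inner ℝ ξ (v - z) ≤ ε * ‖v - z‖ := by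
  -- Otherwise normalized violating differences accumulate at a tangent `w` with `⟨ξ, w⟩ ≥ ε`,
  -- against polarity; the step sizes are `‖v k - z‖`.
  by_contra! hcon
  choose v hvΩ hvr hv using fun k : ℕ => hcon (1 / ((k : ℝ) + 1)) Nat.one_div_pos_of_nat
  have hpos : ∀ k, 0 < ‖v k - z‖ := by
    intro k
    refine norm_pos_iff.2 fun h0 => ?_
    have := hv k
    simp [h0] at this
  have hmem : ∀ k, ‖v k - z‖⁻¹ • (v k - z) ∈ Metric.sphere (0 : E) 1 := by
    intro k
    simp [norm_smul, (hpos k).ne']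
  obtain ⟨w, -, φ, hφ, hlim⟩ := (isCompact_sphere (0 : E) 1).tendsto_subseq hmem
  have hw : w ∈ bouligandCone Ω z := by
    refine ⟨hξ.1, fun k => ‖v (φ k) - z‖, _, ⟨fun k => hpos _, ?_⟩, hlim, fun k => ?_⟩
    · refine squeeze_zero (fun k => norm_nonneg _) (fun k => hvr (φ k)) ?_
      exact tendsto_one_div_add_atTop_nhds_zero_nat.comp hφ.tendsto_atTop
    · simpa [smul_smul, (hpos (φ k)).ne'] using hvΩ (φ k)
  have hle : ε ≤ inner ℝ ξ w := by
    refine ge_of_tendsto' ((tendsto_const_nhds (x := ξ)).inner hlim) fun k => ?_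
    simp only [Function.comp, inner_smul_right]
    rw [inv_mul_eq_div, le_div_iff₀ (hpos _)]
    exact (hv (φ k)).le
  exact absurd (hξ.2 w hw) (by linarith)

theorem bouligandCone_subset_posTangentConeAt (Ω : Set E) (z : E) :
    bouligandCone Ω z ⊆ posTangentConeAt Ω z := by
  rintro w ⟨-, t, wk, ht, hw, hmem⟩
  refine mem_tangentConeAt_of_seq atTop (fun k => (⟨(t k)⁻¹, (inv_pos.2 (ht.1 k)).le⟩ : NNReal))
    (fun k => t k • wk k) ?_ (Eventually.of_forall hmem) ?_
  · simpa using ht.2.smul hw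
  · refine hw.congr fun k => ?_
    change wk k = (t k)⁻¹ • t k • wk k
    rw [inv_smul_smul₀ (ht.1 k).ne']

/-- Fermat's rule: minus the gradient at a local minimizer is a regular normal. -/
theorem mem_regularNormalCone_of_isLocalMinOn {Ω : Set E} {z ξ : E} {f : E → ℝ}
    {f' : E →L[ℝ] ℝ} (hz : z ∈ Ω) (hmin : IsLocalMinOn f Ω z) (hf : HasFDerivAt f f' z)
    (hξ : ∀ w, f' w = -inner ℝ ξ w) : ξ ∈ regularNormalCone Ω z := by
  refine ⟨hz, fun w hw => ?_⟩
  have := hmin.hasFDerivWithinAt_nonneg hf.hasFDerivWithinAt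
    (bouligandCone_subset_posTangentConeAt Ω z hw)
  rw [hξ] at this
  linarith

theorem hasFDerivAt_smoothNorm_sub {δ : ℝ} (hδ : 0 < δ) (L : E →L[ℝ] F) (c : F) (v : E) :
    HasFDerivAt (fun v => smoothNorm δ (L v - c))
      ((smoothNorm δ (L v - c))⁻¹ • (innerSL ℝ (L v - c)).comp L) v := by
  have h := ((L.hasFDerivAt (x := v)).sub_const c).norm_sq.add_const (δ ^ 2)
  have h0 : (‖L v - c‖ ^ 2 + δ ^ 2) ≠ 0 := by positivity
  refine (h.sqrt h0).congr_fderiv ?_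
  ext w
  simp [smoothNorm]
  ring

end RegularNormals

/-! ### Decoupling by penalized minimization -/

section Decoupling

variable {E F F₁ F₂ : Type*} [NormedAddCommGroup E] [InnerProductSpace ℝ E]
  [NormedAddCommGroup F] [InnerProductSpace ℝ F]
  [NormedAddCommGroup F₁] [InnerProductSpace ℝ F₁]
  [NormedAddCommGroup F₂] [InnerProductSpace ℝ F₂]

/-- Fermat's rule for one block with the other frozen: `y` stands for the first component of the
other minimizer, and the subtracted vectors are the gradients of the two smoothed terms. -/
theorem mem_regularNormalCone_of_penalized_min {G : Set (L2Prod E F)} {ω v ℓ : L2Prod E F}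
    {y : E} {a K δ r : ℝ} (hδ : 0 < δ) (hv : v ∈ G) (hvr : ‖v - ω‖ < r)
    (hmin : ∀ u ∈ G, ‖u - ω‖ ≤ r →
      a * smoothNorm δ (v - ω) + K * smoothNorm δ (v.fst - y) - inner ℝ ℓ v ≤
        a * smoothNorm δ (u - ω) + K * smoothNorm δ (u.fst - y) - inner ℝ ℓ u) :
    ℓ - pair ((K * (smoothNorm δ (v.fst - y))⁻¹) • (v.fst - y)) (0 : F) -
      (a * (smoothNorm δ (v - ω))⁻¹) • (v - ω) ∈ regularNormalCone G v := by
  have h₁ := (hasFDerivAt_smoothNorm_sub hδ (ContinuousLinearMap.id ℝ (L2Prod E F)) ω v).const_mul a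
  have h₂ := (hasFDerivAt_smoothNorm_sub hδ (WithLp.fstL 2 ℝ E F) y v).const_mul K
  have h₃ := (innerSL ℝ ℓ).hasFDerivAt (x := v)
  refine mem_regularNormalCone_of_isLocalMinOn hv
    (isLocalMinOn_of_isMinOn_inter_closedBall hvr hmin) ((h₁.add h₂).sub h₃) fun w => ?_
  have hfst : ∀ p : L2Prod E F, WithLp.fstL 2 ℝ E F p = p.fst := fun _ => rfl
  simp only [sub_apply, add_apply, smul_apply, ContinuousLinearMap.comp_apply, ContinuousLinearMap.id_apply,
    innerSL_apply_apply, hfst, smul_eq_mul, inner_sub_left, real_inner_smul_left,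
    WithLp.prod_inner_apply, inner_zero_left, WithLp.ofLp_fst, WithLp.ofLp_snd, WithLp.sub_fst,
    WithLp.sub_snd, WithLp.smul_fst, WithLp.smul_snd]
  ring

/-- Decoupling: a linear form bounded on `G₁ × G₂` by a small multiple of the distance plus a
multiple of the gap between the first components splits into nearby regular normals. -/
theorem exists_regularNormals_of_le_norm_fst_sub [ProperSpace (L2Prod E F₁)]
    [ProperSpace (L2Prod E F₂)] {G₁ : Set (L2Prod E F₁)} {G₂ : Set (L2Prod E F₂)}
    (hG₁ : IsClosed G₁) (hG₂ : IsClosed G₂) {ω₁ ℓ₁ : L2Prod E F₁} {ω₂ ℓ₂ : L2Prod E F₂}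
    (hω₁ : ω₁ ∈ G₁) (hω₂ : ω₂ ∈ G₂) (hω : ω₁.fst = ω₂.fst) {ε K r : ℝ} (hε : 0 < ε)
    (hK : 0 ≤ K) (hr : 0 < r)
    (h : ∀ v₁ ∈ G₁, ∀ v₂ ∈ G₂, ‖v₁ - ω₁‖ ≤ r → ‖v₂ - ω₂‖ ≤ r →
      inner ℝ ℓ₁ (v₁ - ω₁) + inner ℝ ℓ₂ (v₂ - ω₂) ≤
        ε * (‖v₁ - ω₁‖ + ‖v₂ - ω₂‖) + K * ‖v₁.fst - v₂.fst‖) :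
    ∃ (v₁ e₁ : L2Prod E F₁) (v₂ e₂ : L2Prod E F₂) (c : E),
      ‖v₁ - ω₁‖ < r ∧ ‖v₂ - ω₂‖ < r ∧ ‖c‖ ≤ K ∧ ‖e₁‖ ≤ 2 * ε ∧ ‖e₂‖ ≤ 2 * ε ∧
      ℓ₁ - pair c 0 - e₁ ∈ regularNormalCone G₁ v₁ ∧
      ℓ₂ - pair (-c) 0 - e₂ ∈ regularNormalCone G₂ v₂ := by
  -- The smoothed terms of `Φ` equal `(4 * ε + K) * δ` at `(ω₁, ω₂)`; keeping this below `ε * r`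
  -- forces the minimizer into the open balls.
  obtain ⟨δ, hδ, hδr⟩ : ∃ δ > 0, (4 * ε + K) * δ < ε * r := by
    refine ⟨ε * r / (2 * (4 * ε + K)), by positivity, ?_⟩
    have : (4 * ε + K) * (ε * r / (2 * (4 * ε + K))) = ε * r / 2 := by field_simp
    rw [this]
    exact half_lt_self (by positivity)
  -- Of the weight `2 * ε`, one half absorbs the error in `h` and the other half bounds the distance
  -- of the minimizer from `(ω₁, ω₂)`.
  let Φ : L2Prod E F₁ × L2Prod E F₂ → ℝ := fun p =>
    2 * ε * smoothNorm δ (p.1 - ω₁) + 2 * ε * smoothNorm δ (p.2 - ω₂) +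
      K * smoothNorm δ (p.1.fst - p.2.fst) - inner ℝ ℓ₁ p.1 - inner ℝ ℓ₂ p.2
  have hΦ : Continuous Φ := by
    have h₁ : Continuous fun p : L2Prod E F₁ × L2Prod E F₂ => p.1.fst :=
      (WithLp.continuous_fst ..).comp continuous_fst
    have h₂ : Continuous fun p : L2Prod E F₁ × L2Prod E F₂ => p.2.fst :=
      (WithLp.continuous_fst ..).comp continuous_snd
    have h₃ := (continuous_smoothNorm (E := E) δ).comp (h₁.sub h₂)
    have h₄ := (continuous_smoothNorm (E := L2Prod E F₁) δ).comp
      ((continuous_fst (Y := L2Prod E F₂)).sub (continuous_const (y := ω₁)))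
    have h₅ := (continuous_smoothNorm (E := L2Prod E F₂) δ).comp
      ((continuous_snd (X := L2Prod E F₁)).sub (continuous_const (y := ω₂)))
    exact ((((continuous_const.mul h₄).add (continuous_const.mul h₅)).add
      (continuous_const.mul h₃)).sub (continuous_const.inner continuous_fst)).sub
      (continuous_const.inner continuous_snd)
  have hball₁ : ∀ v, v ∈ Metric.closedBall ω₁ r ↔ ‖v - ω₁‖ ≤ r := by simp [dist_eq_norm]
  have hball₂ : ∀ v, v ∈ Metric.closedBall ω₂ r ↔ ‖v - ω₂‖ ≤ r := by simp [dist_eq_norm]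
  have hcomp : IsCompact ((G₁ ∩ Metric.closedBall ω₁ r) ×ˢ (G₂ ∩ Metric.closedBall ω₂ r)) :=
    ((isCompact_closedBall ω₁ r).inter_left hG₁).prod ((isCompact_closedBall ω₂ r).inter_left hG₂)
  have hbase : (ω₁, ω₂) ∈ (G₁ ∩ Metric.closedBall ω₁ r) ×ˢ (G₂ ∩ Metric.closedBall ω₂ r) :=
    ⟨⟨hω₁, Metric.mem_closedBall_self hr.le⟩, hω₂, Metric.mem_closedBall_self hr.le⟩
  obtain ⟨⟨v₁, v₂⟩, ⟨⟨hv₁, hb₁⟩, hv₂, hb₂⟩, hmin⟩ :=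
    hcomp.exists_isMinOn ⟨_, hbase⟩ hΦ.continuousOn
  rw [hball₁] at hb₁
  rw [hball₂] at hb₂
  have hmin' : ∀ u₁ ∈ G₁, ∀ u₂ ∈ G₂, ‖u₁ - ω₁‖ ≤ r → ‖u₂ - ω₂‖ ≤ r →
      Φ (v₁, v₂) ≤ Φ (u₁, u₂) := fun u₁ hu₁ u₂ hu₂ hr₁ hr₂ =>
    hmin (⟨⟨hu₁, (hball₁ _).2 hr₁⟩, hu₂, (hball₂ _).2 hr₂⟩ :
      (u₁, u₂) ∈ (G₁ ∩ Metric.closedBall ω₁ r) ×ˢ (G₂ ∩ Metric.closedBall ω₂ r))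
  have hlt : ε * (‖v₁ - ω₁‖ + ‖v₂ - ω₂‖) < ε * r := by
    have h₀ := hmin' ω₁ hω₁ ω₂ hω₂ (by simpa using hr.le) (by simpa using hr.le)
    have h₁ := h v₁ hv₁ v₂ hv₂ hb₁ hb₂
    simp only [Φ, hω, sub_self, smoothNorm_zero hδ.le] at h₀
    rw [inner_sub_right, inner_sub_right] at h₁
    have h₂ := mul_le_mul_of_nonneg_left (norm_le_smoothNorm δ (v₁ - ω₁)) hε.le
    have h₃ := mul_le_mul_of_nonneg_left (norm_le_smoothNorm δ (v₂ - ω₂)) hε.le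
    have h₄ := mul_le_mul_of_nonneg_left (norm_le_smoothNorm δ (v₁.fst - v₂.fst)) hK
    linarith
  have hlt' := lt_of_mul_lt_mul_left hlt hε.le
  have hr₁ : ‖v₁ - ω₁‖ < r := by linarith [norm_nonneg (v₂ - ω₂)]
  have hr₂ : ‖v₂ - ω₂‖ < r := by linarith [norm_nonneg (v₁ - ω₁)]
  have hε2 : 0 ≤ 2 * ε := by positivity
  refine ⟨v₁, _, v₂, _, _, hr₁, hr₂, norm_smul_inv_smoothNorm_le hδ (v₁.fst - v₂.fst) hK,
    norm_smul_inv_smoothNorm_le hδ (v₁ - ω₁) hε2, norm_smul_inv_smoothNorm_le hδ (v₂ - ω₂) hε2,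
    mem_regularNormalCone_of_penalized_min hδ hv₁ hr₁ fun u hu hur => ?_, ?_⟩
  · have := hmin' u hu v₂ hv₂ hur hb₂
    simp only [Φ] at this
    linarith
  -- Reversing the gap turns `-c` into the gradient with respect to the second variable.
  · rw [← smul_neg, neg_sub, smoothNorm_sub_comm δ v₁.fst]
    refine mem_regularNormalCone_of_penalized_min hδ hv₂ hr₂ fun u hu hur => ?_
    have := hmin' v₁ hv₁ u hu hb₁ hur
    simp only [Φ] at this
    rw [smoothNorm_sub_comm δ v₁.fst, smoothNorm_sub_comm δ v₁.fst] at this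
    linarith

end Decoupling

/-! ### Projections of the product graph and the error bound -/

section Projections

variable {E F F₁ F₂ : Type*}

/-- The projection `(x, z₁, z₂) ↦ (x, z₁)`. -/
abbrev projLeft (ω : L2Prod E (L2Prod F₁ F₂)) : L2Prod E F₁ := pair ω.fst ω.snd.fst

/-- The projection `(x, z₁, z₂) ↦ (x, z₂)`. -/
abbrev projRight (ω : L2Prod E (L2Prod F₁ F₂)) : L2Prod E F₂ := pair ω.fst ω.snd.snd

/-- The map `((y₁, z₁), (y₂, z₂)) ↦ (y₁, z₁, z₂)`. -/
abbrev amalgam (a : L2Prod E F₁) (b : L2Prod E F₂) : L2Prod E (L2Prod F₁ F₂) :=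
  pair a.fst (pair a.snd b.snd)

variable [NormedAddCommGroup E] [NormedAddCommGroup F] [NormedAddCommGroup F₁]
  [NormedAddCommGroup F₂]

theorem Filter.Tendsto.pair {α : Type*} {l : Filter α} {f : α → E} {g : α → F} {a : E} {b : F}
    (hf : Tendsto f l (𝓝 a)) (hg : Tendsto g l (𝓝 b)) :
    Tendsto (fun k => _root_.pair (f k) (g k)) l (𝓝 (_root_.pair a b)) :=
  ((WithLp.prod_continuous_toLp 2 E F).tendsto (a, b)).comp (hf.prodMk_nhds hg)

theorem Filter.Tendsto.l2fst {α : Type*} {l : Filter α} {f : α → L2Prod E F} {a : L2Prod E F}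
    (hf : Tendsto f l (𝓝 a)) : Tendsto (fun k => (f k).fst) l (𝓝 a.fst) :=
  ((WithLp.continuous_fst 2 E F).tendsto a).comp hf

theorem Filter.Tendsto.l2snd {α : Type*} {l : Filter α} {f : α → L2Prod E F} {a : L2Prod E F}
    (hf : Tendsto f l (𝓝 a)) : Tendsto (fun k => (f k).snd) l (𝓝 a.snd) :=
  ((WithLp.continuous_snd 2 E F).tendsto a).comp hf

theorem norm_amalgam_sub_le (a : L2Prod E F₁) (b : L2Prod E F₂) (ω : L2Prod E (L2Prod F₁ F₂)) :
    ‖amalgam a b - ω‖ ≤ ‖a - projLeft ω‖ + ‖b - projRight ω‖ := by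
  refine le_of_sq_le_sq ?_ (by positivity)
  have h₁ : ‖amalgam a b - ω‖ ^ 2 = ‖a.fst - ω.fst‖ ^ 2 + ‖(amalgam a b - ω).snd‖ ^ 2 :=
    WithLp.prod_norm_sq_eq_of_L2 _
  have h₂ : ‖(amalgam a b - ω).snd‖ ^ 2 = ‖a.snd - ω.snd.fst‖ ^ 2 + ‖b.snd - ω.snd.snd‖ ^ 2 :=
    WithLp.prod_norm_sq_eq_of_L2 _
  have h₃ : ‖a - projLeft ω‖ ^ 2 = ‖a.fst - ω.fst‖ ^ 2 + ‖a.snd - ω.snd.fst‖ ^ 2 :=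
    WithLp.prod_norm_sq_eq_of_L2 _
  have h₄ : ‖b - projRight ω‖ ^ 2 = ‖b.fst - ω.fst‖ ^ 2 + ‖b.snd - ω.snd.snd‖ ^ 2 :=
    WithLp.prod_norm_sq_eq_of_L2 _
  nlinarith [norm_nonneg (a - projLeft ω), norm_nonneg (b - projRight ω),
    sq_nonneg ‖b.fst - ω.fst‖]

/-- As `amalgam` takes its first component from `a`, the whole of `ξ.fst` is assigned to the first
factor; the multiplier `c` later moves part of it to the second. -/
theorem inner_amalgam_sub [InnerProductSpace ℝ E] [InnerProductSpace ℝ F₁]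
    [InnerProductSpace ℝ F₂] (ξ : L2Prod E (L2Prod F₁ F₂)) (a : L2Prod E F₁) (b : L2Prod E F₂)
    (ω : L2Prod E (L2Prod F₁ F₂)) :
    inner ℝ ξ (amalgam a b - ω) =
      inner ℝ (projLeft ξ) (a - projLeft ω) +
        inner ℝ (pair (0 : E) ξ.snd.snd) (b - projRight ω) := by
  simp [WithLp.prod_inner_apply]
  ring

/-- The error bound for the graph of the product map provided by calmness of the perturbation
map, on the `ρ`-neighbourhood of `ω`. -/
def HasGraphErrorBound (Γ₁ : E → Set F₁) (Γ₂ : E → Set F₂) (κ ρ : ℝ)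
    (ω : L2Prod E (L2Prod F₁ F₂)) : Prop :=
  ∀ a ∈ gph Γ₁, ∀ b ∈ gph Γ₂, ‖a - projLeft ω‖ ≤ ρ → ‖b - projRight ω‖ ≤ ρ →
    ∃ c ∈ gph (productMap Γ₁ Γ₂), ‖amalgam a b - c‖ ≤ κ * ‖a.fst - b.fst‖

/-- Calmness speaks of sequences, the error bound of whole neighbourhoods. Choosing a violating pair
at each `k` where one exists, and the projections of `ω k` elsewhere, gives one sequence whose
eventual estimate excludes violations for large `k`. -/
theorem eventually_hasGraphErrorBound {Γ₁ : E → Set F₁} {Γ₂ : E → Set F₂} {κ : ℝ} {ρ : ℕ → ℝ} {ω : ℕ → L2Prod E (L2Prod F₁ F₂)}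
    (hρ : ∀ k, 0 < ρ k) (hω : ∀ k, ω k ∈ gph (productMap Γ₁ Γ₂))
    (h : ∀ (a : ℕ → L2Prod E F₁) (b : ℕ → L2Prod E F₂), (∀ k, a k ∈ gph Γ₁) →
      (∀ k, b k ∈ gph Γ₂) → (∀ k, ‖a k - projLeft (ω k)‖ ≤ ρ k) →
      (∀ k, ‖b k - projRight (ω k)‖ ≤ ρ k) →
      ∀ᶠ k in atTop, ∃ c ∈ gph (productMap Γ₁ Γ₂),
        ‖amalgam (a k) (b k) - c‖ ≤ κ * ‖(a k).fst - (b k).fst‖) :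
    ∀ᶠ k in atTop, HasGraphErrorBound Γ₁ Γ₂ κ (ρ k) (ω k) := by
  have key : ∀ k, ∃ (a : L2Prod E F₁) (b : L2Prod E F₂), a ∈ gph Γ₁ ∧ b ∈ gph Γ₂ ∧
      ‖a - projLeft (ω k)‖ ≤ ρ k ∧ ‖b - projRight (ω k)‖ ≤ ρ k ∧
      ((∃ c ∈ gph (productMap Γ₁ Γ₂), ‖amalgam a b - c‖ ≤ κ * ‖a.fst - b.fst‖) →
        HasGraphErrorBound Γ₁ Γ₂ κ (ρ k) (ω k)) := by
    intro k
    by_cases hk : HasGraphErrorBound Γ₁ Γ₂ κ (ρ k) (ω k)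
    · exact ⟨projLeft (ω k), projRight (ω k), (hω k).1, (hω k).2, by simpa using (hρ k).le,
        by simpa using (hρ k).le, fun _ => hk⟩
    · have hk' := hk
      simp only [HasGraphErrorBound, not_forall] at hk'
      obtain ⟨a, ha, b, hb, hea, heb, hc⟩ := hk'
      exact ⟨a, b, ha, hb, hea, heb, fun hc' => absurd hc' hc⟩
  choose a b ha hb hea heb himp using key
  exact (h a b ha hb hea heb).mono himp

end Projections

/-! ### Splitting normals to the product graph -/

section ProductMap

variable {E F₁ F₂ : Type*} [NormedAddCommGroup E] [InnerProductSpace ℝ E]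
  [NormedAddCommGroup F₁] [InnerProductSpace ℝ F₁]
  [NormedAddCommGroup F₂] [InnerProductSpace ℝ F₂] {Γ₁ : E → Set F₁} {Γ₂ : E → Set F₂}

theorem exists_regularNormals_of_hasGraphErrorBound [ProperSpace (L2Prod E F₁)]
    [ProperSpace (L2Prod E F₂)] [ProperSpace (L2Prod E (L2Prod F₁ F₂))]
    (hΓ₁ : IsClosed (gph Γ₁)) (hΓ₂ : IsClosed (gph Γ₂)) {ω ξ : L2Prod E (L2Prod F₁ F₂)}
    (hξ : ξ ∈ regularNormalCone (gph (productMap Γ₁ Γ₂)) ω) {κ ρ ε : ℝ} (hκ : 0 < κ)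
    (hρ : 0 < ρ) (hε : 0 < ε) (hbound : HasGraphErrorBound Γ₁ Γ₂ κ ρ ω) :
    ∃ (v₁ e₁ : L2Prod E F₁) (v₂ e₂ : L2Prod E F₂) (c : E),
      ‖v₁ - projLeft ω‖ ≤ ρ ∧ ‖v₂ - projRight ω‖ ≤ ρ ∧ ‖c‖ ≤ (ε + ‖ξ‖) * κ ∧
      ‖e₁‖ ≤ 2 * ε ∧ ‖e₂‖ ≤ 2 * ε ∧
      projLeft ξ - pair c 0 - e₁ ∈ regularNormalCone (gph Γ₁) v₁ ∧
      pair 0 ξ.snd.snd - pair (-c) 0 - e₂ ∈ regularNormalCone (gph Γ₂) v₂ := by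
  obtain ⟨r, hr, hξr⟩ := exists_radius_of_mem_regularNormalCone hξ hε
  -- The corrected point `c` satisfies `‖c - ω‖ ≤ (1 + κ)(‖a - projLeft ω‖ + ‖b - projRight ω‖) ≤
  -- 2(1 + κ)s`, so it stays where the Fréchet inequality is valid.
  obtain ⟨s, hs, hsρ, hsr⟩ : ∃ s > 0, s ≤ ρ ∧ 2 * (1 + κ) * s ≤ r := by
    refine ⟨min ρ (r / (2 * (1 + κ))), by positivity, min_le_left _ _, ?_⟩
    rw [mul_comm, ← le_div_iff₀ (by positivity)]
    exact min_le_right _ _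
  have hK : 0 ≤ (ε + ‖ξ‖) * κ := by positivity
  have hcoupled : ∀ a ∈ gph Γ₁, ∀ b ∈ gph Γ₂, ‖a - projLeft ω‖ ≤ s → ‖b - projRight ω‖ ≤ s →
      inner ℝ (projLeft ξ) (a - projLeft ω) +
          inner ℝ (pair (0 : E) ξ.snd.snd) (b - projRight ω) ≤
        ε * (‖a - projLeft ω‖ + ‖b - projRight ω‖) + (ε + ‖ξ‖) * κ * ‖a.fst - b.fst‖ := by
    intro a ha b hb hea heb
    obtain ⟨c, hc, hcle⟩ := hbound a ha b hb (hea.trans hsρ) (heb.trans hsρ)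
    rw [← inner_amalgam_sub]
    have hv := norm_amalgam_sub_le a b ω
    have hgap : ‖a.fst - b.fst‖ ≤ ‖a - projLeft ω‖ + ‖b - projRight ω‖ := by
      have e : a.fst - b.fst = (a - projLeft ω).fst - (b - projRight ω).fst := by simp
      rw [e]
      exact (norm_sub_le _ _).trans (add_le_add (WithLp.norm_fst_le _ _) (WithLp.norm_fst_le _ _))
    have hcω : ‖c - ω‖ ≤ ‖amalgam a b - ω‖ + ‖amalgam a b - c‖ := by
      have e : c - ω = (amalgam a b - ω) - (amalgam a b - c) := by abel
      rw [e]
      exact norm_sub_le _ _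
    have hcr : ‖c - ω‖ ≤ r := by nlinarith
    have hin := hξr c hc hcr
    have hcs := real_inner_le_norm ξ (amalgam a b - c)
    have hsplit : inner ℝ ξ (amalgam a b - ω) =
        inner ℝ ξ (amalgam a b - c) + inner ℝ ξ (c - ω) := by
      rw [← inner_add_right]; congr 1; abel
    rw [hsplit]
    have t₁ := mul_le_mul_of_nonneg_left hcle (norm_nonneg ξ)
    have t₂ := mul_le_mul_of_nonneg_left
      (hcω.trans (add_le_add hv hcle)) hε.le
    linarith
  obtain ⟨v₁, e₁, v₂, e₂, c, h₁, h₂, h⟩ :=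
    exists_regularNormals_of_le_norm_fst_sub hΓ₁ hΓ₂ hξ.1.1 hξ.1.2 rfl hε hK hs hcoupled
  exact ⟨v₁, e₁, v₂, e₂, c, h₁.le.trans hsρ, h₂.le.trans hsρ, h⟩

/-- Regular normals to the graph of the product map split in the limit into regular normals to the
graphs of the factors at nearby points, provided the graph error bound holds along the sequence. -/
theorem exists_subseq_regularNormals [FiniteDimensional ℝ E] [FiniteDimensional ℝ F₁]
    [FiniteDimensional ℝ F₂] (hΓ₁ : IsClosed (gph Γ₁)) (hΓ₂ : IsClosed (gph Γ₂)) {κ : ℝ}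
    (hκ : 0 < κ) {ρ : ℕ → ℝ} {ω ξ : ℕ → L2Prod E (L2Prod F₁ F₂)} {ξ' : L2Prod E (L2Prod F₁ F₂)}
    (hρ : ∀ k, 0 < ρ k) (hξ : ∀ k, ξ k ∈ regularNormalCone (gph (productMap Γ₁ Γ₂)) (ω k))
    (hlim : Tendsto ξ atTop (𝓝 ξ'))
    (hbound : ∀ᶠ k in atTop, HasGraphErrorBound Γ₁ Γ₂ κ (ρ k) (ω k)) :
    ∃ (φ : ℕ → ℕ) (v₁ ξ₁ : ℕ → L2Prod E F₁) (v₂ ξ₂ : ℕ → L2Prod E F₂) (c : E),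
      Tendsto φ atTop atTop ∧ (∀ j, ‖v₁ j - projLeft (ω (φ j))‖ ≤ ρ (φ j)) ∧
      (∀ j, ‖v₂ j - projRight (ω (φ j))‖ ≤ ρ (φ j)) ∧
      (∀ j, ξ₁ j ∈ regularNormalCone (gph Γ₁) (v₁ j)) ∧
      (∀ j, ξ₂ j ∈ regularNormalCone (gph Γ₂) (v₂ j)) ∧
      Tendsto ξ₁ atTop (𝓝 (pair (ξ'.fst - c) ξ'.snd.fst)) ∧
      Tendsto ξ₂ atTop (𝓝 (pair c ξ'.snd.snd)) := by
  have := FiniteDimensional.proper ℝ E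
  have := FiniteDimensional.proper ℝ (L2Prod E F₁)
  have := FiniteDimensional.proper ℝ (L2Prod E F₂)
  have := FiniteDimensional.proper ℝ (L2Prod E (L2Prod F₁ F₂))
  obtain ⟨N, hN⟩ := eventually_atTop.1 hbound
  -- The shift by `N` skips the indices without an error bound; the tolerance `ε = 1/(k+1)` makes
  -- the remainders `e₁`, `e₂` vanish.
  choose v₁ e₁ v₂ e₂ c hv₁ hv₂ hc he₁ he₂ h₁ h₂ using fun k : ℕ =>
    exists_regularNormals_of_hasGraphErrorBound hΓ₁ hΓ₂ (hξ (k + N)) hκ (hρ (k + N))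
      (Nat.one_div_pos_of_nat (n := k) (α := ℝ)) (hN (k + N) (Nat.le_add_left _ _))
  obtain ⟨B, hB⟩ := isBounded_iff_forall_norm_le.1 (Metric.isBounded_range_of_tendsto ξ hlim)
  have hcB : ∀ k, c k ∈ Metric.closedBall (0 : E) ((1 + B) * κ) := by
    intro k
    rw [mem_closedBall_zero_iff]
    refine (hc k).trans (mul_le_mul_of_nonneg_right (add_le_add ?_ (hB _ ⟨_, rfl⟩)) hκ.le)
    rw [div_le_one (by positivity)]
    exact le_add_of_nonneg_left (Nat.cast_nonneg k)
  obtain ⟨c', -, ψ, hψ, hc'⟩ := (isCompact_closedBall (0 : E) _).tendsto_subseq hcB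
  have hε : Tendsto (fun j => 2 * (1 / ((ψ j : ℝ) + 1))) atTop (𝓝 0) := by
    simpa using (tendsto_one_div_add_atTop_nhds_zero_nat.comp hψ.tendsto_atTop).const_mul (2 : ℝ)
  have hE₁ : Tendsto (fun j => e₁ (ψ j)) atTop (𝓝 0) :=
    squeeze_zero_norm (fun j => he₁ (ψ j)) hε
  have hE₂ : Tendsto (fun j => e₂ (ψ j)) atTop (𝓝 0) :=
    squeeze_zero_norm (fun j => he₂ (ψ j)) hε
  have hφ : Tendsto (fun j => ψ j + N) atTop atTop :=
    (tendsto_add_atTop_nat N).comp hψ.tendsto_atTop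
  have hξφ := hlim.comp hφ
  refine ⟨fun j => ψ j + N, fun j => v₁ (ψ j), _, fun j => v₂ (ψ j), _, c', hφ,
    fun j => hv₁ _, fun j => hv₂ _, fun j => h₁ (ψ j), fun j => h₂ (ψ j), ?_, ?_⟩
  · have := ((hξφ.l2fst.pair hξφ.l2snd.l2fst).sub (hc'.pair (tendsto_const_nhds (x := (0 : F₁))))).sub
      hE₁
    have e : projLeft ξ' - pair c' 0 - 0 = pair (ξ'.fst - c') ξ'.snd.fst := by
      rw [sub_zero, ← WithLp.toLp_sub, Prod.mk_sub_mk, sub_zero]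
    rw [← e]
    exact this
  · have := (((tendsto_const_nhds (x := (0 : E))).pair hξφ.l2snd.l2snd).sub
      (hc'.neg.pair (tendsto_const_nhds (x := (0 : F₂))))).sub hE₂
    have e : pair 0 ξ'.snd.snd - pair (-c') 0 - 0 = pair c' ξ'.snd.snd := by
      rw [sub_zero, ← WithLp.toLp_sub, Prod.mk_sub_mk, sub_zero, zero_sub, neg_neg]
    rw [← e]
    exact this

end ProductMap

/-! ### From calmness to graph points -/

section Calmness

variable {E F₁ F₂ : Type*} [NormedAddCommGroup E] [NormedAddCommGroup F₁] [NormedAddCommGroup F₂]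
  {Γ₁ : E → Set F₁} {Γ₂ : E → Set F₂}

/-- The point of the range of the perturbation map associated with graph points `(y₁, z₁)` and
`(y₂, z₂)`. -/
abbrev perturbedPoint (a : L2Prod E F₁) (b : L2Prod E F₂) :
    L2Prod E (L2Prod (L2Prod F₁ F₂) (L2Prod E E)) :=
  quint a.fst a.snd b.snd a.fst b.fst

/-- Taking `x = a.fst` makes `p₂` the only possibly nonzero parameter, so its norm is exactly the
gap. -/
theorem perturbedPoint_mem {a : L2Prod E F₁} {b : L2Prod E F₂} (ha : a ∈ gph Γ₁)
    (hb : b ∈ gph Γ₂) :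
    perturbedPoint a b ∈ perturbationMap Γ₁ Γ₂ (pair (pair 0 (a.fst - b.fst)) 0) :=
  ⟨a.fst, a.snd, b.snd, a.fst, b.fst, rfl, sub_self _, rfl, ⟨a.snd, ha, sub_self _⟩,
    ⟨b.snd, hb, sub_self _⟩⟩

/-- At parameter zero `x = y₁ = y₂` and `zᵢ ∈ Γᵢ(x)`, so `(x, z₁, z₂)` is in the product graph;
dropping the `y` coordinates cannot increase the norm. -/
theorem exists_graph_point_of_mem_perturbationMap_zero
    {s : L2Prod E (L2Prod (L2Prod F₁ F₂) (L2Prod E E))}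
    (hs : s ∈ perturbationMap Γ₁ Γ₂ 0) (a : L2Prod E F₁) (b : L2Prod E F₂) :
    ∃ c ∈ gph (productMap Γ₁ Γ₂), ‖amalgam a b - c‖ ≤ ‖perturbedPoint a b - s‖ := by
  obtain ⟨x, z₁, z₂, y₁, y₂, rfl, h₁, h₂, ⟨v₁, hv₁, e₁⟩, ⟨v₂, hv₂, e₂⟩⟩ := hs
  obtain rfl : x = y₁ := sub_eq_zero.1 h₁
  obtain rfl : x = y₂ := sub_eq_zero.1 h₂
  obtain rfl : v₁ = z₁ := sub_eq_zero.1 e₁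
  obtain rfl : v₂ = z₂ := sub_eq_zero.1 e₂
  refine ⟨pair x (pair v₁ v₂), ⟨hv₁, hv₂⟩, le_of_sq_le_sq ?_ (norm_nonneg _)⟩
  rw [WithLp.prod_norm_sq_eq_of_L2 (amalgam a b - pair x (pair v₁ v₂)),
    WithLp.prod_norm_sq_eq_of_L2 (perturbedPoint a b - quint x v₁ v₂ x x)]
  have hle := WithLp.norm_fst_le _ (perturbedPoint a b - quint x v₁ v₂ x x).snd
  exact add_le_add (le_refl (‖a.fst - x‖ ^ 2)) (pow_le_pow_left₀ (norm_nonneg _) hle 2)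

/-- Passage from the sequences provided by calmness to points of the graph of the product map. -/
theorem eventually_exists_graph_point {κ : ℝ} {a : ℕ → L2Prod E F₁} {b : ℕ → L2Prod E F₂}
    {s : ℕ → L2Prod E (L2Prod (L2Prod F₁ F₂) (L2Prod E E))}
    (hs : ∀ k, s k ∈ perturbationMap Γ₁ Γ₂ 0)
    (h : ∀ᶠ k in atTop, ‖perturbedPoint (a k) (b k) - s k‖ ≤
      κ * ‖(pair (pair 0 ((a k).fst - (b k).fst)) 0 :
        L2Prod (L2Prod E E) (L2Prod F₁ F₂)) - 0‖) :
    ∀ᶠ k in atTop, ∃ c ∈ gph (productMap Γ₁ Γ₂),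
      ‖amalgam (a k) (b k) - c‖ ≤ κ * ‖(a k).fst - (b k).fst‖ := by
  filter_upwards [h] with k hk
  obtain ⟨c, hc, hle⟩ := exists_graph_point_of_mem_perturbationMap_zero (hs k) (a k) (b k)
  refine ⟨c, hc, hle.trans (hk.trans_eq ?_)⟩
  rw [sub_zero, WithLp.norm_toLp_fst, WithLp.norm_toLp_snd]

theorem Filter.Tendsto.perturbedPoint {α : Type*} {l : Filter α} {a : α → L2Prod E F₁}
    {b : α → L2Prod E F₂} {a' : L2Prod E F₁} {b' : L2Prod E F₂}
    (ha : Tendsto a l (𝓝 a')) (hb : Tendsto b l (𝓝 b')) :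
    Tendsto (fun k => _root_.perturbedPoint (a k) (b k)) l (𝓝 (_root_.perturbedPoint a' b')) :=
  ha.l2fst.pair ((ha.l2snd.pair hb.l2snd).pair (ha.l2fst.pair hb.l2fst))

theorem tendsto_of_norm_sub_le {G α : Type*} [NormedAddCommGroup G] {l : Filter α}
    {a b : α → G} {c : G} {ρ : α → ℝ} (hb : Tendsto b l (𝓝 c)) (hρ : Tendsto ρ l (𝓝 0))
    (h : ∀ k, ‖a k - b k‖ ≤ ρ k) : Tendsto a l (𝓝 c) := by
  simpa using (squeeze_zero_norm h hρ).add hb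

/-- If `a_k` is `o(t_k)`-close to `z + t_k w_k`, then `a_k` converges to `z` from the same
direction with the same step sizes. -/
theorem exists_directions_of_norm_sub_le {G : Type*} [NormedAddCommGroup G] [NormedSpace ℝ G]
    {t ρ : ℕ → ℝ} {a w : ℕ → G} {z w' : G} (ht : ∀ k, 0 < t k) (hρ : Tendsto ρ atTop (𝓝 0))
    (hw : Tendsto w atTop (𝓝 w')) (h : ∀ k, ‖a k - (z + t k • w k)‖ ≤ t k * ρ k) :
    ∃ d : ℕ → G, Tendsto d atTop (𝓝 w') ∧ ∀ k, a k = z + t k • d k := by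
  refine ⟨fun k => (t k)⁻¹ • (a k - z), tendsto_of_norm_sub_le hw hρ fun k => ?_, fun k => ?_⟩
  · have e : (t k)⁻¹ • (a k - z) - w k = (t k)⁻¹ • (a k - (z + t k • w k)) := by
      rw [← sub_sub, smul_sub _ (a k - z), inv_smul_smul₀ (ht k).ne']
    rw [e, norm_smul, norm_inv, Real.norm_eq_abs, abs_of_pos (ht k), inv_mul_le_iff₀ (ht k)]
    exact h k
  · rw [smul_inv_smul₀ (ht k).ne', add_sub_cancel]

end Calmness

/-! ### The four calculus rules -/

section CalculusRules

variable {E F₁ F₂ : Type*} [NormedAddCommGroup E] [InnerProductSpace ℝ E]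
  [NormedAddCommGroup F₁] [InnerProductSpace ℝ F₁]
  [NormedAddCommGroup F₂] [InnerProductSpace ℝ F₂] {Γ₁ : E → Set F₁} {Γ₂ : E → Set F₂}
  {x : E} {z₁ : F₁} {z₂ : F₂}

theorem projLeft_mem_bouligandCone {ω w : L2Prod E (L2Prod F₁ F₂)}
    (hw : w ∈ bouligandCone (gph (productMap Γ₁ Γ₂)) ω) :
    projLeft w ∈ bouligandCone (gph Γ₁) (projLeft ω) := by
  obtain ⟨hω, t, wk, ht, hwk, hmem⟩ := hw
  exact ⟨hω.1, t, fun k => projLeft (wk k), ht, hwk.l2fst.pair hwk.l2snd.l2fst,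
    fun k => (hmem k).1⟩

theorem projRight_mem_bouligandCone {ω w : L2Prod E (L2Prod F₁ F₂)}
    (hw : w ∈ bouligandCone (gph (productMap Γ₁ Γ₂)) ω) :
    projRight w ∈ bouligandCone (gph Γ₂) (projRight ω) := by
  obtain ⟨hω, t, wk, ht, hwk, hmem⟩ := hw
  exact ⟨hω.2, t, fun k => projRight (wk k), ht, hwk.l2fst.pair hwk.l2snd.l2snd,
    fun k => (hmem k).2⟩

theorem graphDeriv_productMap_subset (u : E) :
    graphDeriv (productMap Γ₁ Γ₂) x (pair z₁ z₂) u ⊆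
      prodSet (graphDeriv Γ₁ x z₁ u) (graphDeriv Γ₂ x z₂ u) :=
  fun _ hw => ⟨projLeft_mem_bouligandCone hw, projRight_mem_bouligandCone hw⟩

theorem graphDeriv_productMap_superset
    (hcalm : IsCalmAt (perturbationMap Γ₁ Γ₂) 0 (quint x z₁ z₂ x x)) {u : E}
    (hderiv : ∀ (w₁ : F₁) (w₂ : F₂), w₁ ∈ graphDeriv Γ₁ x z₁ u ∧ w₂ ∈ graphDeriv Γ₂ x z₂ u →
      pair (pair u w₁) (pair u w₂) ∈
        bouligandCone (prodSet (gph Γ₁) (gph Γ₂)) (pair (pair x z₁) (pair x z₂))) :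
    prodSet (graphDeriv Γ₁ x z₁ u) (graphDeriv Γ₂ x z₂ u) ⊆
      graphDeriv (productMap Γ₁ Γ₂) x (pair z₁ z₂) u := by
  intro w hw
  obtain ⟨hbase, t, d, ht, hd, hmem⟩ := hderiv w.fst w.snd hw
  obtain ⟨κ, -, hκ⟩ := hcalm
  let a : ℕ → L2Prod E F₁ := fun k => pair x z₁ + t k • (d k).fst
  let b : ℕ → L2Prod E F₂ := fun k => pair x z₂ + t k • (d k).snd
  have ha : Tendsto a atTop (𝓝 (pair x z₁)) := by
    simpa using (tendsto_const_nhds (x := pair x z₁)).add (ht.2.smul hd.l2fst)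
  have hb : Tendsto b atTop (𝓝 (pair x z₂)) := by
    simpa using (tendsto_const_nhds (x := pair x z₂)).add (ht.2.smul hd.l2snd)
  obtain ⟨s, hs, hsle⟩ := hκ (fun k => perturbedPoint (a k) (b k)) _ (ha.perturbedPoint hb)
    fun k => perturbedPoint_mem (hmem k).1 (hmem k).2
  obtain ⟨N, hN⟩ := eventually_atTop.1 (eventually_exists_graph_point hs hsle)
  choose c hc hcle using fun k => hN (k + N) (Nat.le_add_left _ _)
  have hshift := tendsto_add_atTop_nat N
  -- Both first components tend to `u`, so after multiplication by `t k` the correction is `o(t k)`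
  -- and does not change the direction.
  have hgap : Tendsto (fun k => κ * ‖(d k).fst.fst - (d k).snd.fst‖) atTop (𝓝 0) := by
    simpa using ((hd.l2fst.l2fst.sub hd.l2snd.l2fst).norm).const_mul κ
  have hdir : Tendsto (fun k => amalgam (d k).fst (d k).snd) atTop (𝓝 (pair u w)) :=
    hd.l2fst.l2fst.pair (hd.l2fst.l2snd.pair hd.l2snd.l2snd)
  obtain ⟨e, he, hce⟩ := exists_directions_of_norm_sub_le (a := c) (z := pair x (pair z₁ z₂))
    (fun k => ht.1 (k + N)) (hgap.comp hshift) (hdir.comp hshift) fun k => by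
      have hfst : (a (k + N)).fst - (b (k + N)).fst =
          t (k + N) • ((d (k + N)).fst.fst - (d (k + N)).snd.fst) := by
        simp [a, b, smul_sub]
      have hle := hcle k
      rw [hfst, norm_smul, Real.norm_eq_abs, abs_of_pos (ht.1 _), mul_left_comm,
        norm_sub_rev] at hle
      exact hle
  exact ⟨⟨hbase.1, hbase.2⟩, _, e, ⟨fun k => ht.1 (k + N), ht.2.comp hshift⟩, he,
    fun k => hce k ▸ hc k⟩

/-- The pairing of the combined normal with a tangent `w` is the sum of the two pairings with
`projLeft w` and `projRight w`, each nonpositive. -/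
theorem regularCoderiv_add_subset (zs₁ : F₁) (zs₂ : F₂) :
    regularCoderiv Γ₁ x z₁ zs₁ + regularCoderiv Γ₂ x z₂ zs₂ ⊆
      regularCoderiv (productMap Γ₁ Γ₂) x (pair z₁ z₂) (pair zs₁ zs₂) := by
  rintro _ ⟨x₁, h₁, x₂, h₂, rfl⟩
  refine ⟨⟨h₁.1, h₂.1⟩, fun w hw => ?_⟩
  have i₁ := h₁.2 _ (projLeft_mem_bouligandCone hw)
  have i₂ := h₂.2 _ (projRight_mem_bouligandCone hw)
  simp only [WithLp.prod_inner_apply] at i₁ i₂ ⊢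
  simp [inner_add_left] at i₁ i₂ ⊢
  linarith

variable [FiniteDimensional ℝ E] [FiniteDimensional ℝ F₁] [FiniteDimensional ℝ F₂]

theorem limitingCoderiv_productMap_subset (hΓ₁ : IsClosed (gph Γ₁)) (hΓ₂ : IsClosed (gph Γ₂))
    (hcalm : IsCalmAt (perturbationMap Γ₁ Γ₂) 0 (quint x z₁ z₂ x x)) (zs₁ : F₁) (zs₂ : F₂) :
    limitingCoderiv (productMap Γ₁ Γ₂) x (pair z₁ z₂) (pair zs₁ zs₂) ⊆
      limitingCoderiv Γ₁ x z₁ zs₁ + limitingCoderiv Γ₂ x z₂ zs₂ := by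
  rintro xs ⟨hbase, ω, ξ, hω, hξ, hN⟩
  obtain ⟨κ, hκ, hcalm⟩ := hcalm
  have hρ := tendsto_one_div_add_atTop_nhds_zero_nat (𝕜 := ℝ)
  have hρ0 : ∀ k : ℕ, 0 < 1 / ((k : ℝ) + 1) := fun k => Nat.one_div_pos_of_nat
  have hω₁ : Tendsto (fun k => projLeft (ω k)) atTop (𝓝 (pair x z₁)) :=
    hω.l2fst.pair hω.l2snd.l2fst
  have hω₂ : Tendsto (fun k => projRight (ω k)) atTop (𝓝 (pair x z₂)) :=
    hω.l2fst.pair hω.l2snd.l2snd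
  have hbound := eventually_hasGraphErrorBound (κ := κ) hρ0 (fun k => (hN k).1)
    fun a b ha hb hea heb => by
      obtain ⟨s, hs, hsle⟩ := hcalm (fun k => perturbedPoint (a k) (b k)) _
        ((tendsto_of_norm_sub_le hω₁ hρ hea).perturbedPoint (tendsto_of_norm_sub_le hω₂ hρ heb))
        fun k => perturbedPoint_mem (ha k) (hb k)
      exact eventually_exists_graph_point hs hsle
  obtain ⟨φ, v₁, ξ₁, v₂, ξ₂, c, hφ, hv₁, hv₂, hξ₁, hξ₂, hl₁, hl₂⟩ :=
    exists_subseq_regularNormals hΓ₁ hΓ₂ hκ hρ0 hN hξ hbound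
  exact ⟨xs - c,
    ⟨hbase.1, v₁, ξ₁, tendsto_of_norm_sub_le (hω₁.comp hφ) (hρ.comp hφ) hv₁, hl₁, hξ₁⟩, c,
    ⟨hbase.2, v₂, ξ₂, tendsto_of_norm_sub_le (hω₂.comp hφ) (hρ.comp hφ) hv₂, hl₂, hξ₂⟩,
    sub_add_cancel xs c⟩

theorem dirLimitingCoderiv_productMap_subset (hΓ₁ : IsClosed (gph Γ₁)) (hΓ₂ : IsClosed (gph Γ₂))
    {u : E} {w₁ : F₁} {w₂ : F₂}
    (hcalm : IsCalmAtInDir (perturbationMap Γ₁ Γ₂) 0 (quint x z₁ z₂ x x) (quint u w₁ w₂ u u))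
    (zs₁ : F₁) (zs₂ : F₂) :
    dirLimitingCoderiv (productMap Γ₁ Γ₂) x (pair z₁ z₂) u (pair w₁ w₂) (pair zs₁ zs₂) ⊆
      dirLimitingCoderiv Γ₁ x z₁ u w₁ zs₁ + dirLimitingCoderiv Γ₂ x z₂ u w₂ zs₂ := by
  rintro xs ⟨hbase, t, w, ξ, ht, hw, hξ, hN⟩
  obtain ⟨κ, hκ, hcalm⟩ := hcalm
  have hρ := tendsto_one_div_add_atTop_nhds_zero_nat (𝕜 := ℝ)
  -- Radii of order `o(t k)` keep all nearby graph points in the prescribed direction with the same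
  -- step sizes, so directional calmness applies and the normals found there are directional.
  have hρ0 : ∀ k : ℕ, 0 < t k * (1 / ((k : ℝ) + 1)) :=
    fun k => mul_pos (ht.1 k) Nat.one_div_pos_of_nat
  have hw₁ : Tendsto (fun k => projLeft (w k)) atTop (𝓝 (pair u w₁)) :=
    hw.l2fst.pair hw.l2snd.l2fst
  have hw₂ : Tendsto (fun k => projRight (w k)) atTop (𝓝 (pair u w₂)) :=
    hw.l2fst.pair hw.l2snd.l2snd
  have hbound := eventually_hasGraphErrorBound (κ := κ) hρ0 (fun k => (hN k).1)
    fun a b ha hb hea heb => by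
      obtain ⟨d₁, hd₁, ed₁⟩ := exists_directions_of_norm_sub_le (z := pair x z₁) ht.1 hρ hw₁ hea
      obtain ⟨d₂, hd₂, ed₂⟩ := exists_directions_of_norm_sub_le (z := pair x z₂) ht.1 hρ hw₂ heb
      obtain ⟨s, hs, hsle⟩ := hcalm (fun k => perturbedPoint (a k) (b k)) _
        ⟨t, fun k => perturbedPoint (d₁ k) (d₂ k), ht, hd₁.perturbedPoint hd₂, fun k => by
          beta_reduce
          rw [ed₁ k, ed₂ k]
          rfl⟩
        fun k => perturbedPoint_mem (ha k) (hb k)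
      exact eventually_exists_graph_point hs hsle
  obtain ⟨φ, v₁, ξ₁, v₂, ξ₂, c, hφ, hv₁, hv₂, hξ₁, hξ₂, hl₁, hl₂⟩ :=
    exists_subseq_regularNormals hΓ₁ hΓ₂ hκ hρ0 hN hξ hbound
  obtain ⟨d₁, hd₁, ed₁⟩ := exists_directions_of_norm_sub_le (z := pair x z₁)
    (fun j => ht.1 (φ j)) (hρ.comp hφ) (hw₁.comp hφ) hv₁
  obtain ⟨d₂, hd₂, ed₂⟩ := exists_directions_of_norm_sub_le (z := pair x z₂)
    (fun j => ht.1 (φ j)) (hρ.comp hφ) (hw₂.comp hφ) hv₂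
  have htφ : TendsDownToZero (fun j => t (φ j)) := ⟨fun j => ht.1 _, ht.2.comp hφ⟩
  exact ⟨xs - c, ⟨hbase.1, _, d₁, ξ₁, htφ, hd₁, hl₁, fun j => ed₁ j ▸ hξ₁ j⟩, c,
    ⟨hbase.2, _, d₂, ξ₂, htφ, hd₂, hl₂, fun j => ed₂ j ▸ hξ₂ j⟩, sub_add_cancel xs c⟩

end CalculusRules

theorem mainTheorem10 (n l₁ l₂ : ℕ)
    (Γ₁ : EuclideanSpace ℝ (Fin n) → Set (EuclideanSpace ℝ (Fin l₁)))
    (Γ₂ : EuclideanSpace ℝ (Fin n) → Set (EuclideanSpace ℝ (Fin l₂)))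
    (hΓ₁ : IsClosed (gph Γ₁)) (hΓ₂ : IsClosed (gph Γ₂))
    (x : EuclideanSpace ℝ (Fin n)) (z₁ : EuclideanSpace ℝ (Fin l₁))
    (z₂ : EuclideanSpace ℝ (Fin l₂))
    (hx : pair x (pair z₁ z₂) ∈ gph (productMap Γ₁ Γ₂)) :
    -- graphical derivative
    (∀ u : EuclideanSpace ℝ (Fin n),
      graphDeriv (productMap Γ₁ Γ₂) x (pair z₁ z₂) u ⊆
          prodSet (graphDeriv Γ₁ x z₁ u) (graphDeriv Γ₂ x z₂ u) ∧
      (IsCalmAt (perturbationMap Γ₁ Γ₂) 0 (quint x z₁ z₂ x x) →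
        (∀ (w₁ : EuclideanSpace ℝ (Fin l₁)) (w₂ : EuclideanSpace ℝ (Fin l₂)),
          pair (pair u w₁) (pair u w₂) ∈
              bouligandCone (prodSet (gph Γ₁) (gph Γ₂)) (pair (pair x z₁) (pair x z₂)) ↔
            w₁ ∈ graphDeriv Γ₁ x z₁ u ∧ w₂ ∈ graphDeriv Γ₂ x z₂ u) →
        prodSet (graphDeriv Γ₁ x z₁ u) (graphDeriv Γ₂ x z₂ u) ⊆
          graphDeriv (productMap Γ₁ Γ₂) x (pair z₁ z₂) u)) ∧
    -- regular coderivative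
    (∀ (zs₁ : EuclideanSpace ℝ (Fin l₁)) (zs₂ : EuclideanSpace ℝ (Fin l₂)),
      regularCoderiv Γ₁ x z₁ zs₁ + regularCoderiv Γ₂ x z₂ zs₂ ⊆
        regularCoderiv (productMap Γ₁ Γ₂) x (pair z₁ z₂) (pair zs₁ zs₂)) ∧
    -- limiting coderivative
    (IsCalmAt (perturbationMap Γ₁ Γ₂) 0 (quint x z₁ z₂ x x) →
      ∀ (zs₁ : EuclideanSpace ℝ (Fin l₁)) (zs₂ : EuclideanSpace ℝ (Fin l₂)),
        limitingCoderiv (productMap Γ₁ Γ₂) x (pair z₁ z₂) (pair zs₁ zs₂) ⊆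
          limitingCoderiv Γ₁ x z₁ zs₁ + limitingCoderiv Γ₂ x z₂ zs₂) ∧
    -- directional limiting coderivative
    (∀ (u : EuclideanSpace ℝ (Fin n)) (w₁ : EuclideanSpace ℝ (Fin l₁))
        (w₂ : EuclideanSpace ℝ (Fin l₂)),
      IsCalmAtInDir (perturbationMap Γ₁ Γ₂) 0 (quint x z₁ z₂ x x) (quint u w₁ w₂ u u) →
      ∀ (zs₁ : EuclideanSpace ℝ (Fin l₁)) (zs₂ : EuclideanSpace ℝ (Fin l₂)),
        dirLimitingCoderiv (productMap Γ₁ Γ₂) x (pair z₁ z₂) u (pair w₁ w₂) (pair zs₁ zs₂) ⊆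
          dirLimitingCoderiv Γ₁ x z₁ u w₁ zs₁ + dirLimitingCoderiv Γ₂ x z₂ u w₂ zs₂) := by
  refine ⟨fun u => ⟨graphDeriv_productMap_subset u, fun hcalm hiff =>
    graphDeriv_productMap_superset hcalm fun w₁ w₂ hw => (hiff w₁ w₂).2 hw⟩,
    fun zs₁ zs₂ => regularCoderiv_add_subset zs₁ zs₂,
    fun hcalm zs₁ zs₂ => limitingCoderiv_productMap_subset hΓ₁ hΓ₂ hcalm zs₁ zs₂,
    fun u w₁ w₂ hcalm zs₁ zs₂ =>
      dirLimitingCoderiv_productMap_subset hΓ₁ hΓ₂ hcalm zs₁ zs₂⟩
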